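/- There exist a frequency $\lambda=(\lambda_n)_{n\ge 1}$ (that is, a strictly increasing sequence of nonnegative real numbers tending to $+\infty$), a $\lambda$-Dirichlet group $(G,\beta)$ and a function $f\in H_1^\lambda(G)$ such that, for every $u>0$, the series $$\sum_{n=1}^{+\infty}\widehat f(h_{\lambda_n})\,e^{-u\lambda_n}\,h_{\lambda_n}(\omega)$$ diverges for almost every $\omega\in G$ (with respect to Haar measure). Here a $\lambda$-Dirichlet group is a pair $(G,\beta)$ where $G$ is a compact (Hausdorff) abelian group and $\beta:(\mathbb R,+)\to G$ is a continuous homomorphism with dense range such that for every $n$ there is a (necessarily unique) continuous character $h_{\lambda_n}\in\widehat G$ with $h_{\lambda_n}(\beta(t))=e^{-i\lambda_n t}$ for all $t\in\mathbb R$. With $m_G$ the normalized Haar measure of $G$ and $\widehat f(h)=\int_G f\,\overline{h}\,dm_G$ for $h\in\widehat G$, the space $H_1^\lambda(G)$ consists of all $f\in L^1(G)=L^1(G,m_G)$ such that $\widehat f(h)=0$ for every $h\in\widehat G\setminus\{h_{\lambda_n}: n\ge 1\}$. -/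

import Mathlib

open MeasureTheory Filter Topology

/-- A frequency: a (strictly) increasing sequence of nonnegative real numbers tending to `+∞`. -/
structure IsFrequency (lam : ℕ → ℝ) : Prop where
  strictMono : StrictMono lam
  nonneg : ∀ n, 0 ≤ lam n
  tendsto_atTop : Tendsto lam atTop atTop

/-- The structure of a `lam`-Dirichlet group on the (compact abelian) group `G`: a continuous
homomorphism `β : (ℝ, +) → G` with dense range such that every `t ↦ exp (-i lam n t)` is
of the form `h ∘ β` for a character `h` of `G`. -/
structure DirichletGroup (lam : ℕ → ℝ) (G : Type*) [CommGroup G] [TopologicalSpace G] where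
  β : Multiplicative ℝ →ₜ* G
  denseRange : DenseRange β
  exists_char : ∀ n, ∃ h : PontryaginDual G, ∀ t : ℝ,
    (h (β (Multiplicative.ofAdd t)) : ℂ) = Complex.exp (-Complex.I * (lam n : ℂ) * (t : ℂ))

namespace DirichletGroup

section Characters

variable {lam : ℕ → ℝ} {G : Type*} [CommGroup G] [TopologicalSpace G]

/-- The character `h_{lam n}` of `G`. -/
noncomputable def char (D : DirichletGroup lam G) (n : ℕ) : PontryaginDual G :=
  (D.exists_char n).choose

theorem char_apply_β (D : DirichletGroup lam G) (n : ℕ) (t : ℝ) :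
    (D.char n (D.β (Multiplicative.ofAdd t)) : ℂ) =
      Complex.exp (-Complex.I * (lam n : ℂ) * (t : ℂ)) :=
  (D.exists_char n).choose_spec t

/-- `h_{lam n}` is the only character of `G` with `h_{lam n} ∘ β = exp (-i lam n ·)`. -/
theorem eq_char (D : DirichletGroup lam G) (n : ℕ) (h : PontryaginDual G)
    (hh : ∀ t : ℝ, (h (D.β (Multiplicative.ofAdd t)) : ℂ) =
      Complex.exp (-Complex.I * (lam n : ℂ) * (t : ℂ))) : h = D.char n := by
  have key : (h : G → Circle) = D.char n := by
    refine D.denseRange.equalizer (map_continuous h) (map_continuous (D.char n)) ?_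
    funext t
    apply Circle.ext
    exact (hh t.toAdd).trans (D.char_apply_β n t.toAdd).symm
  exact PontryaginDual.ext fun a => congrFun key a

end Characters

end DirichletGroup

section Fourier

variable (G : Type*) [CommGroup G] [TopologicalSpace G] [IsTopologicalGroup G] [CompactSpace G]
  [MeasurableSpace G] [BorelSpace G]

/-- The Haar measure of the compact group `G`, normalized to have total mass `1`. -/
noncomputable def haarProb : Measure G := Measure.haarMeasure ⊤

instance haarProb_isHaarMeasure : (haarProb G).IsHaarMeasure := by
  unfold haarProb
  infer_instance

instance haarProb_isProbabilityMeasure : IsProbabilityMeasure (haarProb G) :=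
  ⟨by simpa [haarProb] using Measure.haarMeasure_self (K₀ := (⊤ : TopologicalSpace.PositiveCompacts G))⟩

variable {G}

/-- The Fourier coefficient of `f` at the character `h`, `∫ f(ω) conj (h(ω)) dω`. -/
noncomputable def fourierCoeffAt (f : G → ℂ) (h : PontryaginDual G) : ℂ :=
  ∫ ω, f ω * (starRingEnd ℂ) (h ω : ℂ) ∂(haarProb G)

theorem integrable_mul_conj_char {f : G → ℂ} (hf : Integrable f (haarProb G))
    (h : PontryaginDual G) :
    Integrable (fun ω => f ω * (starRingEnd ℂ) (h ω : ℂ)) (haarProb G) := by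
  have hc : Continuous fun ω : G => (starRingEnd ℂ) (h ω : ℂ) :=
    Complex.continuous_conj.comp (continuous_subtype_val.comp (map_continuous h))
  refine hf.mul_bdd (c := 1) ?_ (Eventually.of_forall fun ω => ?_)
  · exact hc.measurable.aestronglyMeasurable
  · rw [RCLike.norm_conj]
    exact (Circle.norm_coe (h ω)).le

namespace DirichletGroup

/-- The Hardy space `H_p^lam(G)`, `1 ≤ p ≤ ∞`: the subspace of those `f` in `L^p(G)` whose Fourier
coefficients vanish off the characters `h_{lam n}`. -/
noncomputable def hardySpace {lam : ℕ → ℝ} (D : DirichletGroup lam G) (p : ENNReal)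
    [hp : Fact (1 ≤ p)] : Submodule ℂ (Lp ℂ p (haarProb G)) where
  carrier := {f | ∀ h : PontryaginDual G, fourierCoeffAt f h ≠ 0 → h ∈ Set.range D.char}
  zero_mem' := by
    intro h hne
    refine absurd ?_ hne
    refine (integral_congr_ae (g := fun _ => (0 : ℂ)) ?_).trans (by simp)
    filter_upwards [Lp.coeFn_zero ℂ p (haarProb G)] with ω hω
    simp
  add_mem' := by
    intro f g hf hg h hne
    by_contra hmem
    apply hne
    have hf0 : fourierCoeffAt f h = 0 := by
      by_contra h0
      exact hmem (hf h h0)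
    have hg0 : fourierCoeffAt g h = 0 := by
      by_contra h0
      exact hmem (hg h h0)
    have hfi := integrable_mul_conj_char ((Lp.memLp f).integrable hp.out) h
    have hgi := integrable_mul_conj_char ((Lp.memLp g).integrable hp.out) h
    have hadd : fourierCoeffAt (f + g : Lp ℂ p (haarProb G)) h
        = fourierCoeffAt f h + fourierCoeffAt g h := by
      unfold fourierCoeffAt
      rw [← integral_add hfi hgi]
      refine integral_congr_ae ?_
      filter_upwards [Lp.coeFn_add f g] with ω hω
      rw [hω, Pi.add_apply, add_mul]
    rw [hadd, hf0, hg0, add_zero]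
  smul_mem' := by
    intro c f hf h hne
    refine hf h fun h0 => hne ?_
    have hsmul : fourierCoeffAt (c • f : Lp ℂ p (haarProb G)) h = c * fourierCoeffAt f h := by
      unfold fourierCoeffAt
      rw [← integral_const_mul]
      refine integral_congr_ae ?_
      filter_upwards [Lp.coeFn_smul c f] with ω hω
      simp [hω, mul_assoc]
    rw [hsmul, h0, mul_zero]

end DirichletGroup

end Fourier

/-! ### Cesàro means and Riesz products -/

/-! The construction transplants Kolmogorov's divergent `L¹` Fourier series into blocks of nearly
constant frequency, so that the damping `exp (-u λ)` is almost a scalar on each block.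

On the circle, take the mean of point masses at `2n` multiplicatively independent points `c j` close
to `n`-th roots of unity. For almost every `z` the quotients `z / c j` are again independent. The
one-sided partial sums of the Fourier series are averages of `(w ^ m - 1) / (w - 1)` with `w = z / c
j`. Choosing `m` to align the phases `w ^ m` (`exists_re_sum_pow_ge`, by Riesz products) makes them
as large as the average of `1 / |w - 1|`, which is of order `log n`. Replacing the point masses by
translates of `|1 + z| ^ (2J)`, normalized, gives polynomials of `L¹`-norm at most `1` with large
partial sums off a small set (`exists_polynomial_large_partial_sums`).

On the torus, with a dense flow of slopes `1` and `√2`, there are characters `ζ k` of arbitrarily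
small frequency `δ k > 0`, and each carries Haar measure to Haar measure. Block `k` is the `k`-th
polynomial in `ζ k`, times a character of frequency `k` and the weight `2⁻ᵏ`. Its frequencies are `k
+ l δ k`, so damping costs a factor `exp (-u k)`, beaten by a lower bound of size `exp (k²)`, and a
negligible error (`norm_sum_damped_ge`). Borel–Cantelli gives divergence almost everywhere. -/

/-- The sequence `g` has Cesàro mean `L`. -/
def HasMean (g : ℕ → ℂ) (L : ℂ) : Prop :=
  Tendsto (fun N : ℕ => (∑ m ∈ Finset.range N, g m) / N) atTop (𝓝 L)

namespace HasMean

theorem add {g g' : ℕ → ℂ} {L L' : ℂ} (h : HasMean g L) (h' : HasMean g' L') :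
    HasMean (fun m => g m + g' m) (L + L') := by
  refine (Tendsto.add h h').congr fun N => ?_
  rw [Finset.sum_add_distrib, add_div]

theorem const_mul {g : ℕ → ℂ} {L : ℂ} (c : ℂ) (h : HasMean g L) :
    HasMean (fun m => c * g m) (c * L) := by
  refine (Tendsto.const_mul c h).congr fun N => ?_
  rw [← Finset.mul_sum, mul_div_assoc]

theorem congr {g g' : ℕ → ℂ} {L L' : ℂ} (h : HasMean g L) (hg : ∀ m, g m = g' m) (hL : L = L') :
    HasMean g' L' := by
  rw [← funext hg, ← hL]
  exact h

theorem sum {ι : Type*} {s : Finset ι} {g : ι → ℕ → ℂ} {L : ι → ℂ}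
    (h : ∀ j ∈ s, HasMean (g j) (L j)) :
    HasMean (fun m => ∑ j ∈ s, g j m) (∑ j ∈ s, L j) := by
  refine (tendsto_finsetSum s h).congr fun N => ?_
  rw [Finset.sum_comm, Finset.sum_div]

theorem one : HasMean (fun _ => 1) 1 := by
  refine tendsto_const_nhds.congr' ?_
  filter_upwards [eventually_gt_atTop 0] with N hN
  have : (N : ℂ) ≠ 0 := by exact_mod_cast hN.ne'
  simp [this]

theorem pow_circle {θ : Circle} (hθ : θ ≠ 1) : HasMean (fun m => (θ : ℂ) ^ m) 0 := by
  have h1 : (θ : ℂ) ≠ 1 := fun h => hθ (Circle.ext (by simpa using h))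
  have h0 : (0 : ℝ) < ‖(θ : ℂ) - 1‖ := norm_pos_iff.2 (sub_ne_zero.2 h1)
  refine squeeze_zero_norm (a := fun N : ℕ => (2 / ‖(θ : ℂ) - 1‖) / N) (fun N => ?_)
    (tendsto_const_div_atTop_nhds_zero_nat _)
  rw [geom_sum_eq h1, norm_div, norm_div, Complex.norm_natCast]
  gcongr
  calc ‖(θ : ℂ) ^ N - 1‖ ≤ ‖(θ : ℂ) ^ N‖ + ‖(1 : ℂ)‖ := norm_sub_le _ _
    _ = 2 := by rw [norm_pow, Circle.norm_coe, one_pow, norm_one]; norm_num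

/-- If `r` is a nonnegative weight of mean `1`, and `r * g` has mean `L`, then `re g` is not
uniformly below `re L`. -/
theorem exists_re_ge {r : ℕ → ℝ} {g : ℕ → ℂ} {L : ℂ} (hr : ∀ m, 0 ≤ r m)
    (h1 : HasMean (fun m => (r m : ℂ)) 1) (h : HasMean (fun m => (r m : ℂ) * g m) L)
    {c : ℝ} (hc : c < L.re) : ∃ m, c ≤ (g m).re := by
  by_contra! hlt
  have hre := (Complex.continuous_re.tendsto _).comp h
  have hre1 := ((Complex.continuous_re.tendsto _).comp h1).const_mul c
  refine absurd (le_of_tendsto_of_tendsto' hre hre1 fun N => ?_) (by simpa using hc)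
  simp only [Function.comp, Complex.div_natCast_re, Complex.re_sum, Complex.re_ofReal_mul,
    Complex.ofReal_re]
  rw [← mul_div_assoc, Finset.mul_sum]
  refine div_le_div_of_nonneg_right (Finset.sum_le_sum fun m _ => ?_) N.cast_nonneg
  rw [mul_comm c]
  exact mul_le_mul_of_nonneg_left (hlt m).le (hr m)

end HasMean

/-- The Riesz product `∏ (1 + Re (u j * w j ^ m))`, as a function of the exponent `m`. -/
noncomputable def rieszProd {ι : Type*} (u w : ι → Circle) (s : Finset ι) (m : ℕ) : ℝ :=
  ∏ j ∈ s, (1 + ((u j * w j ^ m : Circle) : ℂ).re)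

theorem rieszProd_nonneg {ι : Type*} (u w : ι → Circle) (s : Finset ι) (m : ℕ) : 0 ≤ rieszProd u w s m := by
  refine Finset.prod_nonneg fun j _ => ?_
  have := (abs_le.1 ((Complex.abs_re_le_norm _).trans (Circle.norm_coe (u j * w j ^ m)).le)).1
  linarith

/-- The points `w j`, `j ∈ s`, are multiplicatively independent. -/
def MulIndep {ι : Type*} (w : ι → Circle) (s : Finset ι) : Prop :=
  ∀ e : ι → ℤ, (∃ j ∈ s, e j ≠ 0) → ∏ j ∈ s, w j ^ e j ≠ 1

section Riesz

variable {ι : Type*} [DecidableEq ι] (u w : ι → Circle)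

/-- A new factor is a cosine, hence shifts the frequency `θ` by `w a` and `(w a)⁻¹`; all the means
below follow by induction from this. -/
theorem rieszProd_insert_mul {a : ι} {s : Finset ι} (ha : a ∉ s) (θ : Circle) (m : ℕ) :
    (rieszProd u w (insert a s) m : ℂ) * (θ : ℂ) ^ m =
      (rieszProd u w s m : ℂ) * (θ : ℂ) ^ m
      + (u a / 2 * ((rieszProd u w s m : ℂ) * ((θ * w a : Circle) : ℂ) ^ m)
      + ((u a)⁻¹ : Circle) / 2 *
        ((rieszProd u w s m : ℂ) * ((θ * (w a)⁻¹ : Circle) : ℂ) ^ m)) := by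
  have hre : ((((u a * w a ^ m : Circle) : ℂ).re : ℝ) : ℂ) =
      (u a * w a ^ m + ((u a)⁻¹ : Circle) * ((w a)⁻¹ : Circle) ^ m) / 2 := by
    rw [Complex.re_eq_add_conj, ← Circle.coe_inv_eq_conj, mul_inv, ← inv_pow]
    push_cast
    rfl
  rw [rieszProd, Finset.prod_insert ha, ← rieszProd, Complex.ofReal_mul, Complex.ofReal_add, hre]
  push_cast
  rw [mul_pow, mul_pow]
  ring

/-- Expanded, the product is a combination of geometric sequences with ratios `θ * ∏ w j ^ e j`.
None of these is `1`, so every mean vanishes. -/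
theorem hasMean_rieszProd_mul_pow (s : Finset ι) :
    ∀ θ : Circle, (∀ e : ι → ℤ, θ * ∏ j ∈ s, w j ^ e j ≠ 1) →
      HasMean (fun m => (rieszProd u w s m : ℂ) * (θ : ℂ) ^ m) 0 := by
  induction s using Finset.induction_on with
  | empty =>
    intro θ hθ
    refine (HasMean.pow_circle (θ := θ) ?_).congr (fun m => ?_) rfl
    · simpa using hθ 0
    · simp [rieszProd]
  | insert a s ha ih =>
    intro θ hθ
    have key : ∀ k : ℤ, HasMean (fun m => (rieszProd u w s m : ℂ) *
        ((θ * w a ^ k : Circle) : ℂ) ^ m) 0 := by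
      intro k
      refine ih _ fun e => ?_
      have := hθ (Function.update e a k)
      rw [Finset.prod_insert ha, Function.update_self, ← mul_assoc] at this
      rwa [Finset.prod_congr rfl fun j hj => by
        rw [Function.update_of_ne (ne_of_mem_of_not_mem hj ha)]] at this
    have h0 := key 0
    have h1 := (key 1).const_mul (u a / 2)
    have h2 := (key (-1)).const_mul (((u a)⁻¹ : Circle) / 2)
    rw [zpow_zero, mul_one] at h0
    rw [zpow_one] at h1
    rw [zpow_neg_one] at h2
    exact (h0.add (h1.add h2)).congr (fun m => (rieszProd_insert_mul u w ha θ m).symm) (by simp)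

variable {w}

theorem MulIndep.ne_one {s : Finset ι} (h : MulIndep w s) {j : ι} (hj : j ∈ s) :
    w j ≠ 1 := by
  have := h (Pi.single j 1) ⟨j, hj, by simp⟩
  rwa [Finset.prod_eq_single j (fun i _ hi => by simp [hi]) (fun h => absurd hj h),
    Pi.single_eq_same, zpow_one] at this

theorem MulIndep.mono {s t : Finset ι} (h : MulIndep w t) (hst : s ⊆ t) : MulIndep w s := by
  rintro e ⟨j, hj, hej⟩ hp
  refine h (fun i => if i ∈ s then e i else 0) ⟨j, hst hj, by simpa [hj] using hej⟩ ?_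
  rw [← hp, ← Finset.prod_subset hst (fun i _ hi => by simp [hi])]
  exact Finset.prod_congr rfl fun i hi => by simp [hi]

theorem MulIndep.zpow_mul_prod_ne_one {a : ι} {s : Finset ι} (ha : a ∉ s)
    (h : MulIndep w (insert a s)) {k : ℤ} (hk : k ≠ 0) (e : ι → ℤ) :
    w a ^ k * ∏ j ∈ s, w j ^ e j ≠ 1 := by
  have := h (Function.update e a k) ⟨a, Finset.mem_insert_self _ _, by simpa using hk⟩
  rw [Finset.prod_insert ha, Function.update_self] at this
  rwa [Finset.prod_congr rfl fun j hj => by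
    rw [Function.update_of_ne (ne_of_mem_of_not_mem hj ha)]] at this

theorem hasMean_rieszProd {s : Finset ι} (h : MulIndep w s) :
    HasMean (fun m => (rieszProd u w s m : ℂ)) 1 := by
  induction s using Finset.induction_on with
  | empty => exact HasMean.one.congr (fun m => by simp [rieszProd]) rfl
  | insert a s ha ih =>
    have key : ∀ k : ℤ, k ≠ 0 → HasMean (fun m => (rieszProd u w s m : ℂ) *
        ((w a ^ k : Circle) : ℂ) ^ m) 0 := fun k hk =>
      hasMean_rieszProd_mul_pow u w s _ (h.zpow_mul_prod_ne_one ha hk)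
    have h1 := (key 1 one_ne_zero).const_mul (u a / 2)
    have h2 := (key (-1) (by simp)).const_mul (((u a)⁻¹ : Circle) / 2)
    rw [zpow_one] at h1
    rw [zpow_neg_one] at h2
    refine ((ih (h.mono (Finset.subset_insert _ _))).add (h1.add h2)).congr (fun m => ?_) (by simp)
    simpa using (rieszProd_insert_mul u w ha 1 m).symm

/-- Of the three terms of the factor at `a`, only the shift by `(w a)⁻¹` cancels `w a`; independence
kills the other two. -/
theorem hasMean_rieszProd_mul {s : Finset ι} (h : MulIndep w s) {a : ι} (ha : a ∈ s) :
    HasMean (fun m => (rieszProd u w s m : ℂ) * (w a : ℂ) ^ m) (((u a)⁻¹ : Circle) / 2) := by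
  obtain ⟨t, hat, rfl⟩ : ∃ t, a ∉ t ∧ insert a t = s :=
    ⟨s.erase a, Finset.notMem_erase a s, Finset.insert_erase ha⟩
  have key : ∀ k : ℤ, k ≠ 0 → HasMean (fun m => (rieszProd u w t m : ℂ) *
      ((w a ^ k : Circle) : ℂ) ^ m) 0 := fun k hk =>
    hasMean_rieszProd_mul_pow u w t _ (h.zpow_mul_prod_ne_one hat hk)
  have h0 := key 1 one_ne_zero
  have h1 := (key 2 (by simp)).const_mul (u a / 2)
  have h2 := (hasMean_rieszProd u (h.mono (Finset.subset_insert _ _))).const_mul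
    (((u a)⁻¹ : Circle) / 2)
  rw [zpow_one] at h0
  refine (h0.add (h1.add h2)).congr (fun m => ?_) (by simp)
  rw [rieszProd_insert_mul u w hat (w a) m, mul_inv_cancel, zpow_two]
  simp

/-- For multiplicatively independent `w j`, the powers `w j ^ m` can be aligned simultaneously
with prescribed phases, up to a factor `1 / 2` on average. -/
theorem exists_re_sum_pow_ge {s : Finset ι} (h : MulIndep w s) (a : ι → ℂ) :
    ∃ m : ℕ, (∑ j ∈ s, ‖a j‖) / 2 - 1 ≤ (∑ j ∈ s, a j * (w j : ℂ) ^ m).re := by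
  -- With these phases the weighted mean of the sum is exactly `(∑ ‖a j‖) / 2`; the loss of `1` in
  -- the claim gives the strict inequality required by `exists_re_ge`.
  set u : ι → Circle := fun j => Circle.exp (a j).arg
  have hu : ∀ j, a j * ((u j)⁻¹ : Circle) = ‖a j‖ := by
    intro j
    conv_lhs => rw [← Complex.norm_mul_exp_arg_mul_I (a j)]
    rw [← Circle.coe_exp, mul_assoc, ← Circle.coe_mul, mul_inv_cancel, Circle.coe_one, mul_one]
  have hm := HasMean.sum fun j hj => (hasMean_rieszProd_mul u h hj).const_mul (a j)
  refine HasMean.exists_re_ge (rieszProd_nonneg u w s) (hasMean_rieszProd u h)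
    (hm.congr (fun m => ?_) rfl) ?_
  · rw [Finset.mul_sum]
    exact Finset.sum_congr rfl fun j _ => by ring
  · have : ∑ j ∈ s, a j * (((u j)⁻¹ : Circle) / 2 : ℂ) = ((∑ j ∈ s, ‖a j‖) / 2 : ℝ) := by
      rw [Complex.ofReal_div, Complex.ofReal_sum, Finset.sum_div, Complex.ofReal_ofNat]
      exact Finset.sum_congr rfl fun j _ => by rw [← mul_div_assoc, hu]
    rw [this, Complex.ofReal_re]
    linarith

end Riesz

/-! ### Haar measure on compact groups and on the circle -/

noncomputable instance : MeasurableSpace Circle := borel Circle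

instance : BorelSpace Circle := ⟨rfl⟩

section Haar

variable {G : Type*} [CommGroup G] [TopologicalSpace G] [IsTopologicalGroup G] [CompactSpace G]
  [MeasurableSpace G] [BorelSpace G]

theorem map_haarProb {H : Type*} [CommGroup H] [TopologicalSpace H] [IsTopologicalGroup H]
    [CompactSpace H] [T2Space H] [MeasurableSpace H] [BorelSpace H] {f : G →* H}
    (hf : Continuous f) (hs : Function.Surjective f) :
    (haarProb G).map f = haarProb H := by
  have : ((haarProb G).map f).IsHaarMeasure :=
    Measure.isHaarMeasure_map_of_isFiniteMeasure (haarProb G) f hf hs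
  have : IsProbabilityMeasure ((haarProb G).map f) :=
    Measure.isProbabilityMeasure_map hf.measurable.aemeasurable
  exact Measure.isHaarMeasure_eq_of_isProbabilityMeasure _ _

theorem integral_char_eq_zero {h : PontryaginDual G} (hh : h ≠ 1) :
    ∫ ω, (h ω : ℂ) ∂(haarProb G) = 0 := by
  obtain ⟨g, hg⟩ : ∃ g, h g ≠ 1 := by
    by_contra! H
    exact hh (PontryaginDual.ext H)
  have key := integral_mul_left_eq_self (μ := haarProb G) (fun ω => (h ω : ℂ)) g
  simp only [map_mul, Circle.coe_mul, integral_const_mul] at key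
  exact (mul_left_eq_self₀.1 key).resolve_left fun H => hg (Circle.ext (by simpa using H))

end Haar

instance : Nontrivial Circle :=
  ⟨1, Circle.exp Real.pi, fun h => by
    have := congrArg (fun z : Circle => (z : ℂ)) h
    norm_num [Complex.exp_pi_mul_I] at this⟩

/-- Needed for the Haar measure of the circle to have no atoms. -/
instance : (𝓝[≠] (1 : Circle)).NeBot :=
  ConnectedSpace.neBot_nhdsWithin_compl_of_nontrivial_of_t1space 1

theorem Circle.zpow_surjective {k : ℤ} (hk : k ≠ 0) :
    Function.Surjective fun z : Circle => z ^ k := by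
  intro z
  refine ⟨Circle.exp ((z : ℂ).arg / k), ?_⟩
  have hk' : (k : ℝ) ≠ 0 := by exact_mod_cast hk
  simp only
  rw [← Circle.exp_zsmul, zsmul_eq_mul, mul_div_cancel₀ _ hk', Circle.exp_arg]

theorem Circle.haarProb_zpow_eq {k : ℤ} (hk : k ≠ 0) (c : Circle) :
    haarProb Circle {z | z ^ k = c} = 0 := by
  have h := map_haarProb (f := zpowGroupHom (α := Circle) k) (continuous_zpow k)
    (Circle.zpow_surjective hk)
  have h' : haarProb Circle {c} = 0 := measure_singleton c
  rwa [← h, Measure.map_apply (f := zpowGroupHom k) (continuous_zpow k).measurable (measurableSet_singleton c)] at h'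

/-! ### Almost sure independence and the logarithmic lower bound -/

theorem prod_zpow_eq_zpow_sum {ι H : Type*} [CommGroup H] (z : H) (s : Finset ι) (e : ι → ℤ) :
    ∏ j ∈ s, z ^ e j = z ^ ∑ j ∈ s, e j := by
  classical
  induction s using Finset.induction_on with
  | empty => simp
  | insert a s ha ih => rw [Finset.prod_insert ha, Finset.sum_insert ha, zpow_add, ih]

theorem Circle.prod_exp_zpow {ι : Type*} (s : Finset ι) (x : ι → ℝ) (e : ι → ℤ) :
    ∏ j ∈ s, Circle.exp (x j) ^ e j = Circle.exp (∑ j ∈ s, e j * x j) := by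
  classical
  induction s using Finset.induction_on with
  | empty => simp
  | insert a s ha ih =>
    rw [Finset.prod_insert ha, Finset.sum_insert ha, Circle.exp_add, ih, ← zsmul_eq_mul,
      Circle.exp_zsmul]

/-- A relation with exponents `e` reads `z ^ ∑ e = ∏ c j ^ e j`. If `∑ e = 0` it contradicts the
independence of `c`; otherwise its solutions form a null set. -/
theorem ae_mulIndep_div {c : ℕ → Circle} {s : Finset ℕ} (hc : MulIndep c s) :
    ∀ᵐ z ∂(haarProb Circle), MulIndep (fun j => z / c j) s := by
  -- Exponents restricted to the finite set `s` form a countable family, as `ae_all_iff` requires.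
  have : ∀ᵐ z ∂(haarProb Circle), ∀ e : s → ℤ, e ≠ 0 → ∏ j : s, (z / c j) ^ e j ≠ 1 := by
    refine ae_all_iff.2 fun e => ?_
    by_cases he : e = 0
    · exact Eventually.of_forall fun _ h => absurd he h
    have hprod : ∀ z : Circle, ∏ j : s, (z / c j) ^ e j = z ^ (∑ j, e j) / ∏ j : s, c j ^ e j := by
      intro z
      simp_rw [div_zpow]
      rw [Finset.prod_div_distrib, prod_zpow_eq_zpow_sum]
    by_cases hsum : ∑ j, e j = 0
    · refine Eventually.of_forall fun z _ h => ?_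
      rw [hprod, hsum, zpow_zero, one_div, inv_eq_one] at h
      obtain ⟨i, hi⟩ : ∃ i, e i ≠ 0 := Function.ne_iff.1 he
      refine hc (fun j => if hj : j ∈ s then e ⟨j, hj⟩ else 0) ⟨i, i.2, by simpa using hi⟩ ?_
      rw [← h, ← Finset.prod_coe_sort]
      simp
    · have h0 := Circle.haarProb_zpow_eq hsum (∏ j : s, c j ^ e j)
      filter_upwards [measure_eq_zero_iff_ae_notMem.1 h0] with z hz _ h
      rw [hprod, div_eq_one] at h
      exact hz h
  filter_upwards [this] with z hz
  rintro e ⟨i, hi, hei⟩ hp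
  refine hz (fun j => e j) (fun h => hei (congrFun h ⟨i, hi⟩)) ?_
  rw [← hp, ← Finset.prod_coe_sort s fun j => (z / c j) ^ e j]

/-- Points near the roots of unity of order `n`, perturbed by powers of `τ`. -/
noncomputable def perturbedRoot (n : ℕ) (τ : ℝ) (j : ℕ) : Circle :=
  Circle.exp (2 * Real.pi * (j / n + τ ^ (j + 1)))

/-- A relation would make `τ` a root of a nonzero rational polynomial: `e j` is the coefficient of
degree `j + 1`, kept apart from the constant term that collects the roots of unity and the winding
number. -/
theorem mulIndep_perturbedRoot (n : ℕ) {τ : ℝ} (hτ : Transcendental ℚ τ) (s : Finset ℕ) :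
    MulIndep (perturbedRoot n τ) s := by
  rintro e ⟨i, hi, hei⟩ hp
  simp only [perturbedRoot] at hp
  rw [Circle.prod_exp_zpow, Circle.exp_eq_one] at hp
  obtain ⟨k, hk⟩ := hp
  have hk' : ∑ j ∈ s, (e j : ℝ) * (j / n + τ ^ (j + 1)) = k := by
    have : (2 * Real.pi) ≠ 0 := by positivity
    rw [← mul_right_cancel_iff_of_pos Real.two_pi_pos, ← hk, Finset.sum_mul]
    exact Finset.sum_congr rfl fun j _ => by ring
  set p : Polynomial ℚ := ∑ j ∈ s, Polynomial.C (e j : ℚ) * Polynomial.X ^ (j + 1)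
    + Polynomial.C (∑ j ∈ s, (e j : ℚ) * (j / n) - k) with hpdef
  have hroot : Polynomial.aeval τ p = 0 := by
    simp only [hpdef, map_add, map_sum, map_mul, Polynomial.aeval_C, map_pow, Polynomial.aeval_X,
      eq_ratCast]
    push_cast
    rw [← hk']
    simp_rw [mul_add, Finset.sum_add_distrib]
    ring
  have hp0 : p = 0 := transcendental_iff.1 hτ p hroot
  have hcoeff : p.coeff (i + 1) = e i := by
    simp only [hpdef, Polynomial.coeff_add, Polynomial.finsetSum_coeff,
      Polynomial.coeff_C_mul_X_pow, Polynomial.coeff_C_succ, add_left_inj]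
    rw [Finset.sum_ite_eq s i, if_pos hi, add_zero]
  rw [hp0, Polynomial.coeff_zero] at hcoeff
  exact hei (by exact_mod_cast hcoeff.symm)

theorem exists_transcendental_lt {ε : ℝ} (hε : 0 < ε) :
    ∃ τ : ℝ, Transcendental ℚ τ ∧ 0 < τ ∧ τ < ε := by
  obtain ⟨τ, h, h'⟩ := (Set.Countable.dense_compl ℝ (Algebraic.countable ℚ ℝ)).exists_mem_open
    isOpen_Ioo (Set.nonempty_Ioo.2 hε)
  exact ⟨τ, h, h'⟩

theorem Circle.norm_exp_sub_exp_le (x y : ℝ) :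
    ‖(Circle.exp x : ℂ) - Circle.exp y‖ ≤ |x - y| := by
  have h : (Circle.exp x : ℂ) - Circle.exp y =
      Circle.exp y * (Complex.exp (Complex.I * (x - y : ℝ)) - 1) := by
    rw [mul_comm Complex.I, ← Circle.coe_exp, mul_sub, mul_one, ← Circle.coe_mul, ← Circle.exp_add,
      add_sub_cancel]
  rw [h, norm_mul, Circle.norm_coe, one_mul]
  exact Real.norm_exp_I_mul_ofReal_sub_one_le

theorem Circle.exists_exp_eq (z : Circle) : ∃ θ ∈ Set.Ico 0 (2 * Real.pi), Circle.exp θ = z := by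
  obtain ⟨y, hy, h⟩ := Circle.periodic_exp.exists_mem_Ico₀ Real.two_pi_pos (z : ℂ).arg
  exact ⟨y, hy, by rw [← h, Circle.exp_arg]⟩

/-- Going round from the point just before `z`, the `i`-th point met is within `2π (i + 2) / n`:
rounding down and the perturbation each cost at most one step. Using `2n` points allows `n`
consecutive indices without wrapping. -/
theorem sum_norm_inv_sub_one_ge {n : ℕ} (hn : 0 < n) {τ : ℝ} (h0 : 0 < τ) (h1 : τ < 1 / n)
    {z : Circle} (hz : ∀ j ∈ Finset.range (2 * n), z / perturbedRoot n τ j ≠ 1) :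
    n / (2 * Real.pi) * ∑ i ∈ Finset.range n, 1 / ((i : ℝ) + 2) ≤
      ∑ j ∈ Finset.range (2 * n), ‖((z / perturbedRoot n τ j : Circle) - 1 : ℂ)⁻¹‖ := by
  obtain ⟨θ, hθ, rfl⟩ := Circle.exists_exp_eq z
  have hn' : (0 : ℝ) < n := by exact_mod_cast hn
  have hπ := Real.pi_pos
  set t : ℝ := θ / (2 * Real.pi) * n with ht
  have ht0 : 0 ≤ t := mul_nonneg (div_nonneg hθ.1 Real.two_pi_pos.le) hn'.le
  have htn : t < n := by
    have : θ / (2 * Real.pi) < 1 := (div_lt_one Real.two_pi_pos).2 hθ.2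
    nlinarith
  set i₀ := ⌊t⌋₊ with hi₀
  have hi₀n : i₀ < n := (Nat.floor_lt ht0).2 htn
  have hsub : Finset.Ico i₀ (i₀ + n) ⊆ Finset.range (2 * n) := by
    intro j hj
    simp only [Finset.mem_Ico, Finset.mem_range] at hj ⊢
    omega
  refine le_trans ?_ (Finset.sum_le_sum_of_subset_of_nonneg hsub fun _ _ _ => norm_nonneg _)
  rw [Finset.sum_Ico_eq_sum_range, add_tsub_cancel_left, Finset.mul_sum]
  refine Finset.sum_le_sum fun i hi => ?_
  have hj : i₀ + i ∈ Finset.range (2 * n) := by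
    simp only [Finset.mem_range] at hi ⊢
    omega
  have hne := hz _ hj
  have hpos : 0 < ‖((Circle.exp θ / perturbedRoot n τ (i₀ + i) : Circle) : ℂ) - 1‖ :=
    norm_pos_iff.2 (sub_ne_zero.2 fun h => hne (Circle.ext (by simpa using h)))
  have hτ1 : τ < 1 := h1.trans_le (by rw [div_le_one hn']; exact_mod_cast hn)
  have hτpow : τ ^ (i₀ + i + 1) ≤ 1 / n :=
    (pow_le_of_le_one h0.le hτ1.le (by omega)).trans h1.le
  have hτpos : 0 < τ ^ (i₀ + i + 1) := pow_pos h0 _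
  have hfl := Nat.floor_le ht0
  have hfl' := Nat.lt_floor_add_one t
  have hle : ‖((Circle.exp θ / perturbedRoot n τ (i₀ + i) : Circle) : ℂ) - 1‖ ≤
      2 * Real.pi / n * (i + 2) := by
    have hdiv : ((Circle.exp θ / perturbedRoot n τ (i₀ + i) : Circle) : ℂ) - 1 =
        (Circle.exp θ - perturbedRoot n τ (i₀ + i)) / perturbedRoot n τ (i₀ + i) := by
      rw [Circle.coe_div, sub_div, div_self (Circle.coe_ne_zero _)]
    rw [hdiv, norm_div, Circle.norm_coe, div_one]
    refine (Circle.norm_exp_sub_exp_le _ _).trans ?_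
    have hθt : θ = 2 * Real.pi * (t / n) := by
      rw [ht]; field_simp
    have hx : ((i₀ + i : ℕ) : ℝ) / n = i₀ / n + i / n := by push_cast; ring
    have ha : (i₀ : ℝ) / n ≤ t / n := by gcongr
    have hb : t / n ≤ i₀ / n + 1 / n := by rw [← add_div]; gcongr
    have hi0 : (0 : ℝ) ≤ i / n := by positivity
    have e1 : θ - 2 * Real.pi * (((i₀ + i : ℕ) : ℝ) / n + τ ^ (i₀ + i + 1)) =
        2 * Real.pi * (t / n - i₀ / n - i / n - τ ^ (i₀ + i + 1)) := by
      rw [hx]; nth_rewrite 1 [hθt]; ring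
    have e2 : 2 * Real.pi / n * ((i : ℝ) + 2) = 2 * Real.pi * (i / n + 2 * (1 / n)) := by ring
    rw [e1, e2, abs_mul, abs_of_pos Real.two_pi_pos]
    refine mul_le_mul_of_nonneg_left (abs_le.2 ⟨?_, ?_⟩) Real.two_pi_pos.le
    · have : (0 : ℝ) < 1 / n := by positivity
      linarith
    · linarith
  rw [norm_inv]
  calc n / (2 * Real.pi) * (1 / ((i : ℝ) + 2)) = (2 * Real.pi / n * (i + 2))⁻¹ := by
        field_simp
    _ ≤ _ := inv_anti₀ hpos hle

/-- In a geometric sum the term `-(w - 1)⁻¹` thus has positive real part and can be dropped from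
lower bounds. -/
theorem Circle.re_inv_sub_one {w : Circle} (hw : w ≠ 1) : ((w - 1 : ℂ)⁻¹).re = -1 / 2 := by
  have h1 : (w : ℂ) - 1 ≠ 0 := sub_ne_zero.2 fun h => hw (Circle.ext (by simpa using h))
  have h2 : Complex.normSq ((w : ℂ) - 1) ≠ 0 := fun h => h1 (Complex.normSq_eq_zero.1 h)
  have h3 : Complex.normSq ((w : ℂ) - 1) = 2 - 2 * (w : ℂ).re := by
    rw [Complex.normSq_sub, Circle.normSq_coe]
    simp
    norm_num
  rw [Complex.inv_re, div_eq_div_iff h2 two_ne_zero, h3]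
  simp
  ring

/-- Averages of geometric sums at independent points have large partial sums. -/
theorem MulIndep.exists_norm_geom_sum_ge {w : ℕ → Circle} {s : Finset ℕ} (h : MulIndep w s) :
    ∃ m : ℕ, (∑ j ∈ s, ‖((w j : ℂ) - 1)⁻¹‖) / 2 - 1 ≤
      ‖∑ i ∈ Finset.range m, ∑ j ∈ s, (w j : ℂ) ^ i‖ := by
  obtain ⟨m, hm⟩ := exists_re_sum_pow_ge h fun j => ((w j : ℂ) - 1)⁻¹
  refine ⟨m, hm.trans (le_trans ?_ (Complex.re_le_norm _))⟩
  rw [Finset.sum_comm, Complex.re_sum, Complex.re_sum]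
  refine Finset.sum_le_sum fun j hj => ?_
  have hne := h.ne_one hj
  have hre := Circle.re_inv_sub_one hne
  rw [geom_sum_eq fun h => hne (Circle.ext (by simpa using h)), div_eq_mul_inv, sub_mul, one_mul,
    Complex.sub_re, hre, mul_comm]
  linarith

/-! ### Polynomials with small norm and large partial sums -/

theorem Circle.continuous_coe : Continuous fun z : Circle => (z : ℂ) :=
  continuous_subtype_val

theorem Circle.integral_zpow {k : ℤ} (hk : k ≠ 0) :
    ∫ z, ((z ^ k : Circle) : ℂ) ∂(haarProb Circle) = 0 := by
  let χ : Circle →ₜ* Circle := ⟨zpowGroupHom k, continuous_zpow k⟩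
  refine integral_char_eq_zero (h := (χ : PontryaginDual Circle)) fun h => ?_
  obtain ⟨x, y, hxy⟩ := exists_pair_ne Circle
  obtain ⟨a, rfl⟩ := Circle.zpow_surjective hk x
  obtain ⟨b, rfl⟩ := Circle.zpow_surjective hk y
  exact hxy ((DFunLike.congr_fun h a).trans (DFunLike.congr_fun h b).symm)

/-- On the circle `1 + w = w * conj (1 + w)`. Hence this power is unimodular times a positive
kernel, whose integral is the middle coefficient. -/
theorem Circle.one_add_pow (w : Circle) (J : ℕ) :
    (1 + w : ℂ) ^ (2 * J) = w ^ J * (‖(1 + w : ℂ)‖ ^ (2 * J) : ℝ) := by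
  have : (1 + w : ℂ) ^ 2 = w * (‖(1 + w : ℂ)‖ ^ 2 : ℝ) := by
    have hw : (w : ℂ) * (starRingEnd ℂ) w = 1 := by
      rw [Complex.mul_conj, Circle.normSq_coe, Complex.ofReal_one]
    rw [← Complex.normSq_eq_norm_sq, ← Complex.mul_conj, map_add, map_one]
    linear_combination (-1 - (w : ℂ)) * hw
  rw [pow_mul, this, mul_pow, pow_mul]
  push_cast
  rfl

theorem Circle.integral_norm_one_add_pow (J : ℕ) :
    ∫ z, ‖(1 + z : ℂ)‖ ^ (2 * J) ∂(haarProb Circle) = J.centralBinom := by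
  have hexp : ∀ z : Circle, ((‖(1 + z : ℂ)‖ ^ (2 * J) : ℝ) : ℂ) =
      ∑ l ∈ Finset.range (2 * J + 1), ((2 * J).choose l : ℂ) * ((z ^ ((l : ℤ) - J) : Circle) : ℂ) := by
    intro z
    have h0 : (z : ℂ) ^ J ≠ 0 := pow_ne_zero _ (Circle.coe_ne_zero z)
    rw [← mul_right_inj' h0, ← Circle.one_add_pow, add_comm, add_pow, Finset.mul_sum]
    refine Finset.sum_congr rfl fun l _ => ?_
    rw [one_pow, mul_one, zpow_sub, zpow_natCast, zpow_natCast, Circle.coe_mul, Circle.coe_inv,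
      Circle.coe_pow, Circle.coe_pow]
    field_simp
  have hint : ∀ k : ℤ, Integrable (fun z : Circle => ((z ^ k : Circle) : ℂ)) (haarProb Circle) := by
    intro k
    have : Continuous fun z : Circle => ((z ^ k : Circle) : ℂ) :=
      Circle.continuous_coe.comp (continuous_zpow k)
    exact this.integrable_of_hasCompactSupport (HasCompactSupport.of_compactSpace _)
  have key : ((∫ z, ‖(1 + z : ℂ)‖ ^ (2 * J) ∂(haarProb Circle) : ℝ) : ℂ) = J.centralBinom := by
    rw [← integral_complex_ofReal, integral_congr_ae (Eventually.of_forall hexp),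
      integral_finsetSum _ fun l _ => (hint _).const_mul _]
    simp_rw [integral_const_mul]
    rw [Finset.sum_eq_single J]
    · simp [Nat.centralBinom]
    · intro l _ hl
      rw [Circle.integral_zpow (sub_ne_zero.2 (by exact_mod_cast hl)), mul_zero]
    · intro h
      exact absurd (Finset.mem_range.2 (by omega)) h
  exact_mod_cast key

/-- Consecutive ratios are `(J - i) / (J + i + 1)`. Near the middle the normalized kernel therefore
has the Fourier coefficients of a point mass in the limit. -/
theorem tendsto_choose_div_centralBinom (i : ℕ) :
    Tendsto (fun J : ℕ => ((2 * J).choose (J + i) : ℝ) / J.centralBinom) atTop (𝓝 1) := by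
  induction i with
  | zero =>
    refine tendsto_const_nhds.congr fun J => ?_
    have : (J.centralBinom : ℝ) ≠ 0 := by exact_mod_cast J.centralBinom_ne_zero
    rw [add_zero, ← Nat.centralBinom_eq_two_mul_choose, div_self this]
  | succ i ih =>
    have hratio : Tendsto (fun J : ℕ => (1 - (i : ℝ) / J) / (1 + ((i + 1 : ℕ) : ℝ) / J)) atTop
        (𝓝 1) := by
      have h1 := (tendsto_const_div_atTop_nhds_zero_nat (i : ℝ)).const_sub 1
      have h2 := (tendsto_const_div_atTop_nhds_zero_nat ((i + 1 : ℕ) : ℝ)).const_add 1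
      have h := h1.div h2 (by norm_num)
      rwa [sub_zero, add_zero, div_one] at h
    have := ih.mul hratio
    rw [mul_one] at this
    refine this.congr' ?_
    filter_upwards [eventually_gt_atTop i] with J hJ
    have hJ0 : (J : ℝ) ≠ 0 := by exact_mod_cast (by omega : J ≠ 0)
    have hcb : (J.centralBinom : ℝ) ≠ 0 := by exact_mod_cast J.centralBinom_ne_zero
    have hnat := Nat.choose_succ_right_eq (2 * J) (J + i)
    have hR : ((2 * J).choose (J + (i + 1)) : ℝ) * (J + i + 1) =
        (2 * J).choose (J + i) * (J - i) := by
      have hsub : 2 * J - (J + i) = J - i := by omega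
      rw [hsub] at hnat
      rw [← Nat.cast_sub hJ.le]
      exact_mod_cast hnat
    have hpos : (J : ℝ) + i + 1 ≠ 0 := by positivity
    rw [eq_div_iff_mul_eq hpos |>.2 hR]
    push_cast
    have : (J : ℝ) + (i + 1) ≠ 0 := by positivity
    field_simp
    ring

/-- Coefficients of the polynomial `#s⁻¹ ∑ j ∈ s, (c j) ^ J (1 + z / c j) ^ (2 * J)`,
divided by the central binomial coefficient of `J`. -/
noncomputable def kernelCoeff (c : ℕ → Circle) (s : Finset ℕ) (J l : ℕ) : ℂ :=
  (((2 * J).choose l : ℝ) / J.centralBinom : ℝ) *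
    ((s.card : ℂ)⁻¹ * ∑ j ∈ s, ((c j ^ ((J : ℤ) - l) : Circle) : ℂ))

section Kernel

variable (c : ℕ → Circle) (s : Finset ℕ) (J : ℕ)

theorem norm_kernelCoeff_le (l : ℕ) : ‖kernelCoeff c s J l‖ ≤ 1 := by
  have h1 : ((2 * J).choose l : ℝ) / J.centralBinom ≤ 1 :=
    div_le_one_of_le₀ (by exact_mod_cast Nat.choose_le_centralBinom l J) (Nat.cast_nonneg _)
  have h2 : ‖∑ j ∈ s, ((c j ^ ((J : ℤ) - l) : Circle) : ℂ)‖ ≤ s.card := by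
    refine (norm_sum_le _ _).trans ?_
    simp [Circle.norm_coe]
  rw [kernelCoeff, norm_mul, norm_mul, norm_inv, Complex.norm_natCast, Complex.norm_real,
    Real.norm_of_nonneg (by positivity)]
  refine mul_le_one₀ h1 (by positivity) ?_
  calc (s.card : ℝ)⁻¹ * _ ≤ (s.card : ℝ)⁻¹ * s.card := by gcongr
    _ ≤ 1 := inv_mul_le_one

theorem kernelCoeff_mul_pow (z : Circle) (l : ℕ) :
    kernelCoeff c s J l * (z : ℂ) ^ l = (((2 * J).choose l : ℝ) / J.centralBinom : ℝ) *
      ((s.card : ℂ)⁻¹ * ∑ j ∈ s, (c j : ℂ) ^ J * ((z / c j : Circle) : ℂ) ^ l) := by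
  rw [kernelCoeff, mul_assoc, mul_assoc, Finset.sum_mul]
  congr 2
  refine Finset.sum_congr rfl fun j _ => ?_
  rw [← Circle.coe_pow, ← Circle.coe_pow, ← Circle.coe_pow, ← Circle.coe_mul, ← Circle.coe_mul,
    zpow_sub, zpow_natCast, zpow_natCast, div_pow]
  congr 1
  rw [mul_assoc, div_eq_mul_inv, mul_comm (z ^ l)]

theorem sum_kernelCoeff_mul_pow (z : Circle) :
    ∑ l ∈ Finset.range (2 * J + 1), kernelCoeff c s J l * (z : ℂ) ^ l =
      (s.card : ℂ)⁻¹ * ∑ j ∈ s, (c j : ℂ) ^ J *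
        ((1 + (z / c j : Circle) : ℂ) ^ (2 * J) / J.centralBinom) := by
  simp_rw [kernelCoeff_mul_pow, add_comm (1 : ℂ), add_pow, one_pow, mul_one, Finset.sum_div,
    Finset.mul_sum]
  rw [Finset.sum_comm]
  refine Finset.sum_congr rfl fun j _ => Finset.sum_congr rfl fun l _ => ?_
  push_cast
  ring

theorem integral_norm_sum_kernelCoeff_le :
    ∫ z : Circle, ‖∑ l ∈ Finset.range (2 * J + 1), kernelCoeff c s J l * (z : ℂ) ^ l‖
      ∂(haarProb Circle) ≤ 1 := by
  have hcb : (J.centralBinom : ℝ) ≠ 0 := by exact_mod_cast J.centralBinom_ne_zero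
  have hcont : ∀ j, Continuous fun z : Circle =>
      ‖(1 + (z / c j : Circle) : ℂ)‖ ^ (2 * J) / J.centralBinom := fun j =>
    ((continuous_const.add (Circle.continuous_coe.comp
      (continuous_id.div_const (c j)))).norm.pow _).div_const _
  have hint : ∀ {g : Circle → ℝ}, Continuous g → Integrable g (haarProb Circle) := fun hg =>
    hg.integrable_of_hasCompactSupport (HasCompactSupport.of_compactSpace _)
  calc _ ≤ ∫ z : Circle, (s.card : ℝ)⁻¹ * ∑ j ∈ s,
        ‖(1 + (z / c j : Circle) : ℂ)‖ ^ (2 * J) / J.centralBinom ∂(haarProb Circle) := by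
        refine integral_mono (hint ?_) (hint ?_) fun z => ?_
        · exact (continuous_finsetSum _ fun l _ =>
            continuous_const.mul (Circle.continuous_coe.pow l)).norm
        · exact continuous_const.mul (continuous_finsetSum _ fun j _ => hcont j)
        · simp only
          rw [sum_kernelCoeff_mul_pow, norm_mul, norm_inv, Complex.norm_natCast]
          refine mul_le_mul_of_nonneg_left ((norm_sum_le _ _).trans_eq ?_) (by positivity)
          refine Finset.sum_congr rfl fun j _ => ?_
          rw [norm_mul, norm_pow, Circle.norm_coe, one_pow, one_mul, norm_div, norm_pow,
            Complex.norm_natCast]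
    _ = (s.card : ℝ)⁻¹ * ∑ j ∈ s, 1 := by
        rw [integral_const_mul, integral_finsetSum _ fun j _ => hint (hcont j)]
        congr 1
        refine Finset.sum_congr rfl fun j _ => ?_
        rw [integral_div_right_eq_self
          (fun z : Circle => ‖(1 + z : ℂ)‖ ^ (2 * J) / J.centralBinom) (c j),
          integral_div, Circle.integral_norm_one_add_pow, div_self hcb]
    _ ≤ 1 := by
        rw [Finset.sum_const, nsmul_one]
        exact inv_mul_le_one

/-- The factors `c j ^ J` in the kernel make all translates share the single phase `z ^ J` here. -/
theorem sum_Ico_kernelCoeff (z : Circle) (m : ℕ) :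
    ∑ l ∈ Finset.Ico J (J + m), kernelCoeff c s J l * (z : ℂ) ^ l = (z : ℂ) ^ J *
      ∑ i ∈ Finset.range m, (((2 * J).choose (J + i) : ℝ) / J.centralBinom : ℝ) *
        ((s.card : ℂ)⁻¹ * ∑ j ∈ s, ((z / c j : Circle) : ℂ) ^ i) := by
  rw [Finset.sum_Ico_eq_sum_range, add_tsub_cancel_left, Finset.mul_sum]
  refine Finset.sum_congr rfl fun i _ => ?_
  rw [kernelCoeff_mul_pow, mul_left_comm ((z : ℂ) ^ J), mul_left_comm ((z : ℂ) ^ J),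
    Finset.mul_sum (a := (z : ℂ) ^ J)]
  congr 2
  refine Finset.sum_congr rfl fun j _ => ?_
  rw [pow_add, ← mul_assoc, ← mul_pow, ← Circle.coe_mul, mul_div_cancel]

end Kernel

theorem exists_ae_norm_sum_ge (M : ℝ) : ∃ (c : ℕ → Circle) (s : Finset ℕ),
    ∀ᵐ z ∂(haarProb Circle), ∃ m : ℕ,
      M ≤ ‖∑ i ∈ Finset.range m, (s.card : ℂ)⁻¹ * ∑ j ∈ s, ((z / c j : Circle) : ℂ) ^ i‖ := by
  have hlim : Tendsto (fun n : ℕ => ∑ i ∈ Finset.range n, 1 / ((i : ℝ) + 2)) atTop atTop := by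
    have := tendsto_atTop_add_const_right _ (-1)
      ((tendsto_add_atTop_iff_nat 1).2 Real.tendsto_sum_range_one_div_nat_succ_atTop)
    refine this.congr fun n => ?_
    rw [Finset.sum_range_succ']
    push_cast
    simp [add_assoc, one_add_one_eq_two]
  -- The sum of the `‖(w j - 1)⁻¹‖` is then at least `4n (M + 1)`; half of it minus `1` is at least
  -- `2n M`.
  obtain ⟨n, hnS, hn⟩ := ((hlim.eventually_ge_atTop (8 * Real.pi * (M + 1))).and
    (eventually_gt_atTop 0)).exists
  have hn' : (1 : ℝ) ≤ n := by exact_mod_cast hn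
  obtain ⟨τ, hτ, hτ0, hτ1⟩ := exists_transcendental_lt (ε := 1 / n) (by positivity)
  refine ⟨perturbedRoot n τ, Finset.range (2 * n), ?_⟩
  filter_upwards [ae_mulIndep_div (mulIndep_perturbedRoot n hτ (Finset.range (2 * n)))] with z hz
  obtain ⟨m, hm⟩ := hz.exists_norm_geom_sum_ge
  refine ⟨m, ?_⟩
  have hlow := sum_norm_inv_sub_one_ge hn hτ0 hτ1 fun j hj => hz.ne_one hj
  rw [← Finset.mul_sum, norm_mul, norm_inv, Complex.norm_natCast, Finset.card_range]
  have hpos : (0 : ℝ) < (2 * n : ℕ) := by positivity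
  rw [le_inv_mul_iff₀ hpos]
  refine le_trans ?_ hm
  have h1 : (n : ℝ) / (2 * Real.pi) * (8 * Real.pi * (M + 1)) ≤
      n / (2 * Real.pi) * ∑ i ∈ Finset.range n, 1 / ((i : ℝ) + 2) := by gcongr
  have h2 : (n : ℝ) / (2 * Real.pi) * (8 * Real.pi * (M + 1)) = 4 * n * (M + 1) := by
    field_simp
    ring
  rw [Nat.cast_mul, Nat.cast_two]
  linarith

/-- There are polynomials whose `L¹`-norm on the circle is at most `1`, and whose partial sums
are large off a set of small measure. -/
theorem exists_polynomial_large_partial_sums (M : ℝ) {ε : ENNReal} (hε : 0 < ε) :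
    ∃ (J : ℕ) (q : ℕ → ℂ) (E : Set Circle), (∀ l, ‖q l‖ ≤ 1) ∧
      ∫ z : Circle, ‖∑ l ∈ Finset.range (2 * J + 1), q l * (z : ℂ) ^ l‖ ∂(haarProb Circle) ≤ 1 ∧
      MeasurableSet E ∧ haarProb Circle Eᶜ ≤ ε ∧
      ∀ z ∈ E, ∃ m ≤ J, M ≤ ‖∑ l ∈ Finset.Ico J (J + m), q l * (z : ℂ) ^ l‖ := by
  -- The margin `1` lets the bound `M` hold for large `J` before the limit.
  obtain ⟨c, s, hcs⟩ := exists_ae_norm_sum_ge (M + 1)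
  set E : ℕ → Set Circle := fun J =>
    ⋃ m ∈ Set.Iic J, {z | M ≤ ‖∑ l ∈ Finset.Ico J (J + m), kernelCoeff c s J l * (z : ℂ) ^ l‖}
    with hE
  have hmeas : ∀ J, MeasurableSet (E J) := fun J =>
    ((Set.finite_Iic J).isClosed_biUnion fun m _ => isClosed_le continuous_const
      (continuous_finsetSum _ fun l _ =>
        continuous_const.mul (Circle.continuous_coe.pow l)).norm).measurableSet
  have hlim : Tendsto (fun J => haarProb Circle (E J)ᶜ) atTop (𝓝 (haarProb Circle ∅)) := by
    refine tendsto_measure_of_ae_tendsto_indicator_of_isFiniteMeasure atTop MeasurableSet.empty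
      (fun J => (hmeas J).compl) ?_
    filter_upwards [hcs] with z ⟨m, hm⟩
    have hconv : Tendsto (fun J : ℕ => ‖∑ l ∈ Finset.Ico J (J + m),
        kernelCoeff c s J l * (z : ℂ) ^ l‖) atTop
        (𝓝 ‖∑ i ∈ Finset.range m, (s.card : ℂ)⁻¹ * ∑ j ∈ s, ((z / c j : Circle) : ℂ) ^ i‖) := by
      simp_rw [sum_Ico_kernelCoeff, norm_mul, norm_pow, Circle.norm_coe, one_pow, one_mul]
      refine (tendsto_finsetSum _ fun i _ => ?_).norm
      simpa using ((Complex.continuous_ofReal.tendsto _).comp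
        (tendsto_choose_div_centralBinom i)).mul_const
          ((s.card : ℂ)⁻¹ * ∑ j ∈ s, ((z / c j : Circle) : ℂ) ^ i)
    filter_upwards [hconv.eventually_const_le (by linarith : M < _), eventually_ge_atTop m]
      with J hJ hmJ
    simp only [Set.mem_compl_iff, Set.mem_empty_iff_false, iff_false, not_not]
    exact Set.mem_biUnion (Set.mem_Iic.2 hmJ) hJ
  rw [measure_empty] at hlim
  obtain ⟨J, hJ⟩ := (hlim.eventually_lt_const hε).exists
  refine ⟨J, kernelCoeff c s J, E J, norm_kernelCoeff_le c s J,
    integral_norm_sum_kernelCoeff_le c s J, hmeas J, hJ.le, fun z hz => ?_⟩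
  simpa [hE] using hz

/-- Evaluation of characters at a point, as a homomorphism. -/
noncomputable def evalHom {A : Type*} [Monoid A] [TopologicalSpace A] (x : A) :
    PontryaginDual A →* Circle where
  toFun χ := χ x
  map_one' := rfl
  map_mul' _ _ := rfl

/-! ### Functions with prescribed Fourier coefficients -/

section Coefficients

variable {G : Type*} [CommGroup G] [TopologicalSpace G] [IsTopologicalGroup G] [CompactSpace G]
  [MeasurableSpace G] [BorelSpace G]

/-- The Fourier coefficient at `h`, as a continuous linear functional on `L¹`. -/
noncomputable def fourierCoeffCLM (h : PontryaginDual G) : Lp ℂ 1 (haarProb G) →L[ℂ] ℂ :=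
  LinearMap.mkContinuous
    { toFun := fun f => fourierCoeffAt f h
      map_add' := fun f g => by
        unfold fourierCoeffAt
        rw [← integral_add (integrable_mul_conj_char (L1.integrable_coeFn f) h)
          (integrable_mul_conj_char (L1.integrable_coeFn g) h)]
        refine integral_congr_ae ?_
        filter_upwards [Lp.coeFn_add f g] with ω hω
        rw [hω, Pi.add_apply, add_mul]
      map_smul' := fun c f => by
        unfold fourierCoeffAt
        rw [RingHom.id_apply, smul_eq_mul, ← integral_const_mul]
        refine integral_congr_ae ?_
        filter_upwards [Lp.coeFn_smul c f] with ω hω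
        rw [hω, Pi.smul_apply, smul_eq_mul, mul_assoc] }
    1 fun f => by
      rw [one_mul, L1.norm_eq_integral_norm]
      refine (norm_integral_le_integral_norm _).trans_eq (integral_congr_ae ?_)
      filter_upwards with ω
      rw [norm_mul, RCLike.norm_conj, Circle.norm_coe, mul_one]

theorem fourierCoeffCLM_apply (h : PontryaginDual G) (f : Lp ℂ 1 (haarProb G)) :
    fourierCoeffCLM h f = fourierCoeffAt f h := rfl

/-- A character, as a continuous complex valued function. -/
noncomputable def charFunction (h : PontryaginDual G) : C(G, ℂ) :=
  ⟨fun ω => (h ω : ℂ), Circle.continuous_coe.comp (map_continuous h)⟩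

/-- The inclusion of the continuous functions into `L¹`. -/
noncomputable abbrev continuousToL1 : C(G, ℂ) →L[ℂ] Lp ℂ 1 (haarProb G) :=
  ContinuousMap.toLp 1 (haarProb G) ℂ

theorem norm_continuousToL1 (g : C(G, ℂ)) :
    ‖continuousToL1 g‖ = ∫ ω, ‖g ω‖ ∂(haarProb G) := by
  rw [L1.norm_eq_integral_norm]
  refine integral_congr_ae ?_
  filter_upwards [ContinuousMap.coeFn_toLp (p := 1) (𝕜 := ℂ) (haarProb G) g] with ω hω
  rw [hω]

theorem fourierCoeffCLM_charFunction (h h' : PontryaginDual G) [Decidable (h = h')] :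
    fourierCoeffCLM h' (continuousToL1 (charFunction h)) = if h = h' then 1 else 0 := by
  rw [fourierCoeffCLM_apply, fourierCoeffAt]
  have : ∫ ω, continuousToL1 (charFunction h) ω * (starRingEnd ℂ) (h' ω : ℂ) ∂(haarProb G) =
      ∫ ω, ((h * h'⁻¹) ω : ℂ) ∂(haarProb G) := by
    refine integral_congr_ae ?_
    filter_upwards [ContinuousMap.coeFn_toLp (p := 1) (𝕜 := ℂ) (haarProb G) (charFunction h)]
      with ω hω
    rw [hω, ← Circle.coe_inv_eq_conj]
    rfl
  rw [this]
  split_ifs with hh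
  · subst hh
    rw [mul_inv_cancel]
    simp [PontryaginDual.one_apply]
  · exact integral_char_eq_zero fun H => hh (mul_inv_eq_one.1 H)

/-- Polynomials in the characters `h_{lam n}`, grouped in blocks, sum to a function in the Hardy
space with the expected Fourier coefficients if the blocks are absolutely summable in `L¹`. -/
theorem DirichletGroup.exists_mem_hardySpace {lam : ℕ → ℝ} (D : DirichletGroup lam G)
    (hD : Function.Injective D.char) (c : ℕ → ℂ) {s : ℕ → ℕ} {blk : ℕ → ℕ}
    (hblk : ∀ n k, n ∈ Finset.Ico (s k) (s (k + 1)) ↔ blk n = k)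
    (hsum : Summable fun k => ∫ ω, ‖∑ n ∈ Finset.Ico (s k) (s (k + 1)), c n * (D.char n ω : ℂ)‖
      ∂(haarProb G)) :
    ∃ f ∈ D.hardySpace 1, ∀ n, fourierCoeffAt f (D.char n) = c n := by
  classical
  set g : ℕ → C(G, ℂ) := fun k => ∑ n ∈ Finset.Ico (s k) (s (k + 1)), c n • charFunction (D.char n)
  have hnorm : ∀ k, ‖continuousToL1 (g k)‖ =
      ∫ ω, ‖∑ n ∈ Finset.Ico (s k) (s (k + 1)), c n * (D.char n ω : ℂ)‖ ∂(haarProb G) := by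
    intro k
    rw [norm_continuousToL1]
    simp only [g, ContinuousMap.sum_apply, ContinuousMap.smul_apply, smul_eq_mul]
    rfl
  have hs : Summable fun k => continuousToL1 (g k) := by
    refine Summable.of_norm ?_
    simp_rw [hnorm]
    exact hsum
  have hcoeff : ∀ h, HasSum (fun k => ∑ n ∈ Finset.Ico (s k) (s (k + 1)),
      c n * if D.char n = h then 1 else 0) (fourierCoeffCLM h (∑' k, continuousToL1 (g k))) := by
    intro h
    refine ((fourierCoeffCLM h).hasSum hs.hasSum).congr_fun fun k => ?_
    simp only [g, map_sum, map_smul, smul_eq_mul, fourierCoeffCLM_charFunction]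
  refine ⟨∑' k, continuousToL1 (g k), fun h hne => ?_, fun n => ?_⟩
  · by_contra hmem
    refine hne ((hcoeff h).unique ?_)
    convert hasSum_zero with k
    refine Finset.sum_eq_zero fun n _ => ?_
    rw [if_neg fun H => hmem ⟨n, H⟩, mul_zero]
  · refine (hcoeff (D.char n)).unique ?_
    have hterm : ∀ k, ∑ m ∈ Finset.Ico (s k) (s (k + 1)),
        c m * (if D.char m = D.char n then 1 else 0) = if blk n = k then c n else 0 := by
      intro k
      simp_rw [hD.eq_iff, mul_ite, mul_one, mul_zero, Finset.sum_ite_eq', hblk]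
    simp_rw [hterm]
    simpa [eq_comm] using hasSum_ite_eq (blk n) (c n)

end Coefficients

theorem not_tendsto_of_frequently_norm_ge_one {v : ℕ → ℂ}
    (h : ∃ᶠ k in atTop, ∃ a b : ℕ, k ≤ a ∧ a ≤ b ∧ 1 ≤ ‖∑ n ∈ Finset.Ico a b, v n‖) :
    ¬ ∃ l : ℂ, Tendsto (fun N : ℕ => ∑ n ∈ Finset.range N, v n) atTop (𝓝 l) := by
  rintro ⟨l, hl⟩
  obtain ⟨N, hN⟩ := Metric.cauchySeq_iff.1 hl.cauchySeq 1 one_pos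
  obtain ⟨k, hk, a, b, hka, hab, hge⟩ := (frequently_atTop.1 h) N
  have := hN b (hk.trans (hka.trans hab)) a (hk.trans hka)
  rw [dist_eq_norm, ← Finset.sum_Ico_eq_sub _ hab] at this
  exact absurd hge this.not_ge

/-! ### Block sequences -/

theorem exists_block {s : ℕ → ℕ} (hs : StrictMono s) (h0 : s 0 = 0) :
    ∃ blk : ℕ → ℕ, ∀ n k, n ∈ Finset.Ico (s k) (s (k + 1)) ↔ blk n = k := by
  have hex : ∀ n, ∃ k, s k ≤ n ∧ n < s (k + 1) := by
    intro n
    refine ⟨Nat.findGreatest (fun k => s k ≤ n) n, ?_, ?_⟩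
    · exact Nat.findGreatest_spec (P := fun k => s k ≤ n) (Nat.zero_le n) (by simp [h0])
    · by_contra! hle
      have := Nat.le_findGreatest (P := fun k => s k ≤ n) ((hs.le_apply).trans hle) hle
      omega
  choose blk h1 h2 using hex
  refine ⟨blk, fun n k => ?_⟩
  rw [Finset.mem_Ico]
  constructor
  · rintro ⟨ha, hb⟩
    have h3 := hs.lt_iff_lt.1 ((h1 n).trans_lt hb)
    have h4 := hs.lt_iff_lt.1 (ha.trans_lt (h2 n))
    omega
  · rintro rfl
    exact ⟨h1 n, h2 n⟩

/-- Block `k` starts at the integer `k` and, by `hδ1`, stays below `k + 1`. -/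
theorem isFrequency_block {s blk : ℕ → ℕ} (hs : StrictMono s)
    (hblk : ∀ n k, n ∈ Finset.Ico (s k) (s (k + 1)) ↔ blk n = k) {δ : ℕ → ℝ} (hδ : ∀ k, 0 < δ k)
    (hδ1 : ∀ k, ((s (k + 1) - s k : ℕ) : ℝ) * δ k ≤ 1) :
    IsFrequency fun n => blk n + ((n - s (blk n) : ℕ) : ℝ) * δ (blk n) := by
  have hmem : ∀ n, s (blk n) ≤ n ∧ n < s (blk n + 1) := fun n =>
    Finset.mem_Ico.1 ((hblk n (blk n)).2 rfl)
  have hnn : ∀ n, (0 : ℝ) ≤ ((n - s (blk n) : ℕ) : ℝ) * δ (blk n) := fun n =>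
    mul_nonneg (Nat.cast_nonneg _) (hδ _).le
  refine ⟨strictMono_nat_of_lt_succ fun n => ?_, fun n => add_nonneg (Nat.cast_nonneg _) (hnn n),
    tendsto_atTop_mono (fun n => le_add_of_nonneg_right (hnn n))
      (tendsto_natCast_atTop_atTop.comp (tendsto_atTop.2 fun k => ?_))⟩
  · obtain ⟨h1, h2⟩ := hmem n
    rcases Nat.lt_or_ge (n + 1) (s (blk n + 1)) with h | h
    · have heq : blk (n + 1) = blk n := (hblk _ _).1 (Finset.mem_Ico.2 ⟨by omega, h⟩)
      rw [heq]
      have : n - s (blk n) < n + 1 - s (blk n) := by omega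
      have := mul_lt_mul_of_pos_right (Nat.cast_lt (α := ℝ).2 this) (hδ (blk n))
      linarith
    · have heq : blk (n + 1) = blk n + 1 :=
        (hblk _ _).1 (Finset.mem_Ico.2 ⟨h, by have := hs (Nat.lt_add_one (blk n + 1)); omega⟩)
      have hlt : n - s (blk n) < s (blk n + 1) - s (blk n) := by omega
      have := mul_lt_mul_of_pos_right (Nat.cast_lt (α := ℝ).2 hlt) (hδ (blk n))
      have h3 := hδ1 (blk n)
      have h4 := hnn (n + 1)
      rw [heq] at h4 ⊢
      push_cast at h4 ⊢
      linarith
  · filter_upwards [eventually_ge_atTop (s k)] with n hn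
    have := hs.lt_iff_lt.1 (hn.trans_lt (hmem n).2)
    omega

/-! ### A Dirichlet group on the two-dimensional torus -/

section Torus

/-- The one-parameter subgroup `t ↦ (exp (-i t), exp (-i √2 t))` of the torus. -/
noncomputable def torusFlow : Multiplicative ℝ →ₜ* Circle × Circle where
  toFun t := (Circle.exp (-t.toAdd), Circle.exp (-(√2 * t.toAdd)))
  map_one' := by simp
  map_mul' a b := by
    simp only [toAdd_mul, neg_add, mul_add, Circle.exp_add, Prod.mk_mul_mk]
  continuous_toFun := by
    have h : Continuous fun t : Multiplicative ℝ => t.toAdd := continuous_toAdd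
    exact (Circle.exp.continuous.comp h.neg).prodMk
      (Circle.exp.continuous.comp (continuous_const.mul h).neg)

theorem torusFlow_ofAdd (t : ℝ) :
    torusFlow (Multiplicative.ofAdd t) = (Circle.exp (-t), Circle.exp (-(√2 * t))) := rfl

theorem denseRange_exp_int_mul_sqrt_two :
    DenseRange fun n : ℤ => Circle.exp (n * (2 * Real.pi * √2)) := by
  have hd : Dense (AddSubgroup.closure {2 * Real.pi * √2, 2 * Real.pi} : Set ℝ) := by
    rw [dense_addSubgroupClosure_pair_iff, mul_div_cancel_left₀ _ Real.two_pi_pos.ne']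
    exact irrational_sqrt_two
  refine (Circle.exp_surjective.denseRange.dense_image Circle.exp.continuous hd).mono ?_
  rintro _ ⟨x, hx, rfl⟩
  obtain ⟨m, n, rfl⟩ := AddSubgroup.mem_closure_pair.1 hx
  refine ⟨m, ?_⟩
  simp only [zsmul_eq_mul]
  rw [Circle.exp_add, Circle.exp_int_mul_two_pi, mul_one]

/-- The times that hit a given first coordinate differ by multiples of `2π`, and along these the
second coordinate is dense. -/
theorem denseRange_torusFlow : DenseRange torusFlow := by
  refine dense_iff_inter_open.2 fun U hU ⟨⟨z, w⟩, hzw⟩ => ?_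
  obtain ⟨t, rfl⟩ := Circle.exp_surjective z
  have hcont : Continuous fun y : Circle => (Circle.exp t, Circle.exp (√2 * t) * y) :=
    continuous_const.prodMk (continuous_const.mul continuous_id)
  obtain ⟨y, hy, n, rfl⟩ := dense_iff_inter_open.1 denseRange_exp_int_mul_sqrt_two _
    (hU.preimage hcont) ⟨(Circle.exp (√2 * t))⁻¹ * w, by simpa using hzw⟩
  refine ⟨_, hy, Multiplicative.ofAdd (-(t + n * (2 * Real.pi))), ?_⟩
  simp only [torusFlow_ofAdd]
  rw [neg_neg, Circle.exp_add t, Circle.exp_int_mul_two_pi, mul_one, ← Circle.exp_add]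
  congr 2
  ring

/-- The character `χ` of the torus has frequency `a` along the flow. -/
def HasFreq (χ : PontryaginDual (Circle × Circle)) (a : ℝ) : Prop :=
  ∀ t : ℝ, χ (torusFlow (Multiplicative.ofAdd t)) = Circle.exp (-(a * t))

namespace HasFreq

variable {χ χ' : PontryaginDual (Circle × Circle)} {a b : ℝ}

theorem mul (h : HasFreq χ a) (h' : HasFreq χ' b) : HasFreq (χ * χ') (a + b) := fun t => by
  rw [add_mul, neg_add, Circle.exp_add, ← h t, ← h' t]
  rfl

theorem zpow (h : HasFreq χ a) (k : ℤ) : HasFreq (χ ^ k) (k * a) := fun t => by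
  have : Circle.exp (-(k * a * t)) = Circle.exp (-(a * t)) ^ k := by
    rw [← Circle.exp_zsmul, zsmul_eq_mul]
    congr 1
    ring
  rw [this, ← h t]
  exact map_zpow (evalHom (torusFlow (Multiplicative.ofAdd t))) χ k

theorem pow (h : HasFreq χ a) (k : ℕ) : HasFreq (χ ^ k) (k * a) := by
  simpa using h.zpow k

theorem coe_apply (h : HasFreq χ a) (t : ℝ) :
    (χ (torusFlow (Multiplicative.ofAdd t)) : ℂ) =
      Complex.exp (-Complex.I * (a : ℂ) * (t : ℂ)) := by
  rw [h t, Circle.coe_exp]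
  congr 1
  push_cast
  ring

theorem surjective (h : HasFreq χ a) (ha : a ≠ 0) : Function.Surjective χ := by
  intro z
  obtain ⟨x, rfl⟩ := Circle.exp_surjective z
  refine ⟨_, (h (-x / a)).trans ?_⟩
  congr 1
  field_simp

theorem exists_one : ∃ χ, HasFreq χ 1 :=
  ⟨(ContinuousMonoidHom.fst Circle Circle : (Circle × Circle) →ₜ* Circle), fun t => by
    rw [one_mul]
    rfl⟩

theorem exists_sqrt_two : ∃ χ, HasFreq χ √2 :=
  ⟨(ContinuousMonoidHom.snd Circle Circle : (Circle × Circle) →ₜ* Circle), fun _ => rfl⟩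

/-- The frequencies `m √2 + n` are dense in `ℝ`; this is why the torus has dimension two. -/
theorem exists_small {ε : ℝ} (hε : 0 < ε) : ∃ χ a, HasFreq χ a ∧ 0 < a ∧ a < ε := by
  obtain ⟨χ, hχ⟩ := exists_one
  obtain ⟨χ', hχ'⟩ := exists_sqrt_two
  have hd : Dense (AddSubgroup.closure {√2, 1} : Set ℝ) := by
    rw [dense_addSubgroupClosure_pair_iff, div_one]
    exact irrational_sqrt_two
  obtain ⟨a, ha, haε⟩ := hd.exists_mem_open isOpen_Ioo (Set.nonempty_Ioo.2 hε)
  obtain ⟨m, n, rfl⟩ := AddSubgroup.mem_closure_pair.1 ha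
  refine ⟨χ' ^ m * χ ^ n, _, ?_, haε⟩
  rw [zsmul_eq_mul, zsmul_eq_mul]
  exact (hχ'.zpow m).mul (hχ.zpow n)

end HasFreq

end Torus

/-! ### Assembly of the counterexample -/

theorem DirichletGroup.char_injective {lam : ℕ → ℝ} (hlam : Function.Injective lam) {G : Type*}
    [CommGroup G] [TopologicalSpace G] (D : DirichletGroup lam G) :
    Function.Injective D.char := by
  intro m n hmn
  by_contra hne
  have hsub : lam m - lam n ≠ 0 := sub_ne_zero.2 fun h => hne (hlam h)
  -- At this time the two exponentials differ by the factor `-1`.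
  set t : ℝ := Real.pi / (lam m - lam n) with ht
  have h := D.char_apply_β m t
  rw [hmn, D.char_apply_β n t] at h
  have hexp : Complex.exp (-Complex.I * lam m * t) =
      Complex.exp (-Complex.I * lam n * t) * Complex.exp (-(Real.pi * Complex.I)) := by
    rw [← Complex.exp_add]
    congr 1
    have : (Real.pi : ℂ) = (lam m - lam n) * t := by
      rw [ht]
      push_cast
      field_simp [show (lam m - lam n : ℂ) ≠ 0 by exact_mod_cast hsub]
    rw [this]
    ring
  rw [hexp, Complex.exp_neg, Complex.exp_pi_mul_I] at h
  have h0 := Complex.exp_ne_zero (-Complex.I * lam n * t)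
  have : (1 : ℂ) = (-1)⁻¹ := mul_left_cancel₀ h0 (by rw [mul_one]; exact h)
  norm_num at this

/-- As `1 - exp (-x) ≤ x`, each of at most `L` terms changes by at most `u L δ`, in total by at most
`u L² δ ≤ u`. -/
theorem norm_sum_damped_ge {q : ℕ → ℂ} (hq : ∀ l, ‖q l‖ ≤ 1) {I : Finset ℕ} {L : ℕ}
    (hI : I ⊆ Finset.range L) {δ : ℝ} (hδ : 0 ≤ δ) (hL : (L : ℝ) ^ 2 * δ ≤ 1) {u : ℝ} (hu : 0 ≤ u)
    (z : Circle) :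
    ‖∑ l ∈ I, q l * (z : ℂ) ^ l‖ - u ≤
      ‖∑ l ∈ I, q l * (Real.exp (-u * (l * δ)) : ℂ) * (z : ℂ) ^ l‖ := by
  rw [sub_le_comm]
  refine (norm_sub_norm_le _ _).trans ?_
  rw [← Finset.sum_sub_distrib]
  have hterm : ∀ l ∈ I, ‖q l * (z : ℂ) ^ l - q l * (Real.exp (-u * (l * δ)) : ℂ) * (z : ℂ) ^ l‖ ≤
      u * (L * δ) := by
    intro l hl
    have hlL : (l : ℝ) ≤ L := by exact_mod_cast (Finset.mem_range.1 (hI hl)).le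
    have h0 : 0 ≤ u * (l * δ) := by positivity
    have hfac : q l * (z : ℂ) ^ l - q l * (Real.exp (-u * (l * δ)) : ℂ) * (z : ℂ) ^ l =
        q l * (z : ℂ) ^ l * ((1 - Real.exp (-u * (l * δ)) : ℝ) : ℂ) := by
      push_cast
      ring
    have h1 := Real.add_one_le_exp (-u * (l * δ))
    have h2 : Real.exp (-u * (l * δ)) ≤ 1 := Real.exp_le_one_iff.2 (by linarith)
    rw [hfac, norm_mul, norm_mul, norm_pow, Circle.norm_coe, one_pow, mul_one, Complex.norm_real,
      Real.norm_of_nonneg (by linarith)]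
    calc ‖q l‖ * (1 - Real.exp (-u * (l * δ))) ≤ 1 * (u * (l * δ)) :=
          mul_le_mul (hq l) (by linarith) (by linarith) zero_le_one
      _ ≤ u * (L * δ) := by rw [one_mul]; gcongr
  calc _ ≤ ∑ l ∈ I, u * (L * δ) := norm_sum_le_of_le _ hterm
    _ = I.card * (u * (L * δ)) := by rw [Finset.sum_const, nsmul_eq_mul]
    _ ≤ L * (u * (L * δ)) := by
        gcongr
        simpa using Finset.card_le_card hI
    _ = u * (L ^ 2 * δ) := by ring
    _ ≤ u := mul_le_of_le_one_right hu hL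

theorem mainTheorem4 :
    ∃ lam : ℕ → ℝ, IsFrequency lam ∧
      ∃ (G : Type) (_ : CommGroup G) (_ : TopologicalSpace G) (_ : IsTopologicalGroup G)
        (_ : CompactSpace G) (_ : T2Space G) (_ : MeasurableSpace G) (_ : BorelSpace G)
        (D : DirichletGroup lam G) (f : Lp ℂ 1 (haarProb G)),
        f ∈ D.hardySpace 1 ∧
        ∀ u : ℝ, 0 < u → ∀ᵐ ω ∂(haarProb G),
          ¬ ∃ l : ℂ, Tendsto
            (fun N : ℕ => ∑ n ∈ Finset.range N,
              fourierCoeffAt f (D.char n) * (Real.exp (-u * lam n) : ℂ) * (D.char n ω : ℂ))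
            atTop (𝓝 l) := by
  choose J q E hq hint hmeas hE hlarge using fun k : ℕ =>
    -- `2 ^ k` offsets the weight of the block, `exp (k²)` beats `exp (-u k)` once `k ≥ u`, and the
    -- summand `k` absorbs the damping error `u`.
    exists_polynomial_large_partial_sums (2 ^ k * (Real.exp (k ^ 2) + k))
      (ε := (2⁻¹ : ENNReal) ^ k) (ENNReal.pow_pos (by simp) k)
  set L : ℕ → ℕ := fun k => 2 * J k + 1 with hL
  have hL1 : ∀ k, (1 : ℝ) ≤ L k := fun k => by exact_mod_cast Nat.le_add_left 1 (2 * J k)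
  choose ζ δ hζ hδ hδL using fun k =>
    HasFreq.exists_small (ε := 1 / (L k : ℝ) ^ 2) (by have := hL1 k; positivity)
  have hLδ : ∀ k, (L k : ℝ) ^ 2 * δ k ≤ 1 := fun k =>
    (le_div_iff₀' (by have := hL1 k; positivity)).1 (hδL k).le
  obtain ⟨κ, hκ⟩ := HasFreq.exists_one
  set s : ℕ → ℕ := fun k => ∑ i ∈ Finset.range k, L i with hs_def
  have hs_succ : ∀ k, s (k + 1) = s k + L k := fun k => Finset.sum_range_succ _ _
  have hs : StrictMono s := strictMono_nat_of_lt_succ fun k => by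
    rw [hs_succ]
    exact Nat.lt_add_of_pos_right (Nat.succ_pos _)
  obtain ⟨blk, hblk⟩ := exists_block hs (by simp [hs_def])
  have hblk_add : ∀ k l, l < L k → blk (s k + l) = k := fun k l hl =>
    (hblk _ _).1 (Finset.mem_Ico.2 ⟨Nat.le_add_right _ _, by rw [hs_succ]; omega⟩)
  set lam : ℕ → ℝ := fun n => blk n + ((n - s (blk n) : ℕ) : ℝ) * δ (blk n) with hlam_def
  have hlam : IsFrequency lam := by
    refine isFrequency_block hs hblk hδ fun k => ?_
    rw [hs_succ, Nat.add_sub_cancel_left]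
    refine le_trans ?_ (hLδ k)
    exact mul_le_mul_of_nonneg_right (le_self_pow₀ (hL1 k) two_ne_zero) (hδ k).le
  have hfreq : ∀ n, HasFreq (κ ^ blk n * ζ (blk n) ^ (n - s (blk n))) (lam n) := fun n => by
    simpa using (hκ.pow (blk n)).mul ((hζ (blk n)).pow (n - s (blk n)))
  let D : DirichletGroup lam (Circle × Circle) :=
    ⟨torusFlow, denseRange_torusFlow, fun n => ⟨_, (hfreq n).coe_apply⟩⟩
  have hchar : ∀ n ω, (D.char n ω : ℂ) =
      (κ ω : ℂ) ^ blk n * (ζ (blk n) ω : ℂ) ^ (n - s (blk n)) := by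
    intro n ω
    rw [← D.eq_char n _ (hfreq n).coe_apply, ← Circle.coe_pow, ← Circle.coe_pow, ← Circle.coe_mul]
    congr 1
    exact (map_mul (evalHom ω) _ _).trans
      (congrArg₂ _ (map_pow (evalHom ω) κ _) (map_pow (evalHom ω) (ζ _) _))
  -- This transfers both the `L¹` bounds and the exceptional sets from the circle to the torus.
  have hmap : ∀ k, (haarProb (Circle × Circle)).map (ζ k) = haarProb Circle := fun k =>
    map_haarProb (f := ((ζ k : (Circle × Circle) →ₜ* Circle) : (Circle × Circle) →* Circle))
      (map_continuous (ζ k)) ((hζ k).surjective (hδ k).ne')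
  set c : ℕ → ℂ := fun n => (2⁻¹ : ℝ) ^ blk n * q (blk n) (n - s (blk n)) with hc_def
  have hsum : Summable fun k => ∫ ω, ‖∑ n ∈ Finset.Ico (s k) (s (k + 1)),
      c n * (D.char n ω : ℂ)‖ ∂(haarProb (Circle × Circle)) := by
    refine Summable.of_nonneg_of_le (fun k => integral_nonneg fun ω => norm_nonneg _) (fun k => ?_)
      (summable_geometric_of_lt_one (r := (2⁻¹ : ℝ)) (by norm_num) (by norm_num))
    have hblock : ∀ ω, ‖∑ n ∈ Finset.Ico (s k) (s (k + 1)), c n * (D.char n ω : ℂ)‖ =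
        (2⁻¹ : ℝ) ^ k * ‖∑ l ∈ Finset.range (2 * J k + 1), q k l * (ζ k ω : ℂ) ^ l‖ := by
      intro ω
      have : ∑ n ∈ Finset.Ico (s k) (s (k + 1)), c n * (D.char n ω : ℂ) =
          (((2⁻¹ : ℝ) ^ k : ℝ) : ℂ) * ((κ ω : ℂ) ^ k *
            ∑ l ∈ Finset.range (2 * J k + 1), q k l * (ζ k ω : ℂ) ^ l) := by
        rw [hs_succ, Finset.sum_Ico_eq_sum_range, add_tsub_cancel_left, Finset.mul_sum,
          Finset.mul_sum]
        refine Finset.sum_congr rfl fun l hl => ?_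
        simp only [hc_def]
        rw [hchar, hblk_add k l (Finset.mem_range.1 hl), add_tsub_cancel_left]
        push_cast
        ring
      rw [this, norm_mul, norm_mul, norm_pow, Circle.norm_coe, one_pow, one_mul, Complex.norm_real,
        Real.norm_of_nonneg (by positivity)]
    simp_rw [hblock]
    rw [integral_const_mul]
    refine mul_le_of_le_one_right (by positivity) ?_
    have hcont : Continuous fun z : Circle =>
        ‖∑ l ∈ Finset.range (2 * J k + 1), q k l * (z : ℂ) ^ l‖ :=
      (continuous_finsetSum _ fun l _ => continuous_const.mul (Circle.continuous_coe.pow l)).norm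
    have := hint k
    rwa [← hmap k, integral_map (map_continuous (ζ k)).measurable.aemeasurable
      hcont.aestronglyMeasurable] at this
  obtain ⟨f, hf, hfc⟩ := D.exists_mem_hardySpace (D.char_injective hlam.strictMono.injective) c
    hblk hsum
  refine ⟨lam, hlam, Circle × Circle, inferInstance, inferInstance, inferInstance, inferInstance,
    inferInstance, inferInstance, inferInstance, D, f, hf, fun u hu => ?_⟩
  have hBC : ∀ᵐ ω ∂(haarProb (Circle × Circle)), ∀ᶠ k in atTop, ω ∉ ζ k ⁻¹' (E k)ᶜ := by
    refine ae_eventually_notMem (ne_top_of_le_ne_top ?_ (ENNReal.tsum_le_tsum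
      (g := fun k => (2⁻¹ : ENNReal) ^ k) fun k => ?_))
    · rw [ENNReal.tsum_geometric, ENNReal.one_sub_inv_two, inv_inv]
      exact ENNReal.ofNat_ne_top
    · rw [← Measure.map_apply (map_continuous (ζ k)).measurable (hmeas k).compl, hmap k]
      exact hE k
  filter_upwards [hBC] with ω hω
  refine not_tendsto_of_frequently_norm_ge_one (Eventually.frequently ?_)
  filter_upwards [hω, eventually_ge_atTop ⌈u⌉₊] with k hk hku
  have huk : u ≤ k := Nat.ceil_le.1 hku
  obtain ⟨m, hmJ, hm⟩ := hlarge k (ζ k ω) (by simpa using hk)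
  -- The window is the upper half range `[J k, J k + m)` of the polynomial, shifted to the start `s
  -- k` of block `k`.
  refine ⟨J k + s k, J k + m + s k, le_add_left hs.le_apply, by omega, ?_⟩
  have hsub : Finset.Ico (J k) (J k + m) ⊆ Finset.range (L k) := fun l hl => by
    simp only [Finset.mem_Ico, Finset.mem_range, hL] at hl ⊢
    omega
  have hblock : ∑ n ∈ Finset.Ico (J k + s k) (J k + m + s k),
      fourierCoeffAt f (D.char n) * (Real.exp (-u * lam n) : ℂ) * (D.char n ω : ℂ) =
      (((2⁻¹ : ℝ) ^ k * Real.exp (-u * k) : ℝ) : ℂ) * ((κ ω : ℂ) ^ k *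
        ∑ l ∈ Finset.Ico (J k) (J k + m),
          q k l * (Real.exp (-u * (l * δ k)) : ℂ) * (ζ k ω : ℂ) ^ l) := by
    rw [← Finset.sum_Ico_add, Finset.mul_sum, Finset.mul_sum]
    refine Finset.sum_congr rfl fun l hl => ?_
    have hexp : Real.exp (-u * (k + l * δ k)) = Real.exp (-u * k) * Real.exp (-u * (l * δ k)) := by
      rw [← Real.exp_add, mul_add]
    rw [hfc]
    simp only [hc_def, hlam_def]
    rw [hchar, hblk_add k l (Finset.mem_range.1 (hsub hl)), add_tsub_cancel_left, hexp,
      Complex.ofReal_mul, Complex.ofReal_mul, Complex.ofReal_pow]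
    ring
  rw [hblock, norm_mul, norm_mul, norm_pow, Circle.norm_coe, one_pow, one_mul, Complex.norm_real,
    Real.norm_of_nonneg (by positivity)]
  have hlow := norm_sum_damped_ge (hq k) hsub (hδ k).le (hLδ k) hu.le (ζ k ω)
  have h2k : (1 : ℝ) ≤ 2 ^ k := one_le_pow₀ one_le_two
  have hk0 : (0 : ℝ) ≤ k := k.cast_nonneg
  have hMu : 2 ^ k * Real.exp ((k : ℝ) ^ 2) ≤
      ‖∑ l ∈ Finset.Ico (J k) (J k + m),
        q k l * (Real.exp (-u * (l * δ k)) : ℂ) * (ζ k ω : ℂ) ^ l‖ := by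
    have : (k : ℝ) ≤ 2 ^ k * k := le_mul_of_one_le_left hk0 h2k
    rw [mul_add] at hm
    linarith
  calc (1 : ℝ) ≤ Real.exp (-u * k + (k : ℝ) ^ 2) := Real.one_le_exp (by nlinarith)
    _ = (2⁻¹ : ℝ) ^ k * Real.exp (-u * k) * (2 ^ k * Real.exp ((k : ℝ) ^ 2)) := by
        rw [Real.exp_add, inv_pow]
        field_simp
    _ ≤ _ := by gcongr
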